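/- **Setting.** Let $G=(S,A_1,\Sigma,\Gamma_1,\Gamma_2,\mathbf P,O,\mathsf{Obs},s_0,o_0,F)$ be a stochastic reachability game with active sensing and sensor attacks: $S$, $A_1$ (control actions of P1) and $\Sigma$ (sensors) are finite; $\Gamma_1,\Gamma_2\subseteq 2^\Sigma$ are P1's sensor queries and P2's sensor attacks; $\mathbf P(s,a,\cdot)$ is a probability distribution on $S$ for every $s\in S$, $a\in A_1$; $\mathsf{Obs}:S\times\Gamma_1\times\Gamma_2\to O\subseteq 2^S$; $s_0\in o_0\in O$; and $F\subseteq S$ is the set of P1's goal states. Let $\sigma_0\in\Sigma$ be a sensor hidden from P2, and let $\mathbf A_1=A_1\times\Gamma_1$, $\mathbf A_1^2=\{(a,\gamma_1)\in\mathbf A_1:\sigma_0\notin\gamma_1\}$, $\mathbf A_2=\Gamma_2$, $\mathbf A_2^2=\{\gamma_2\in\Gamma_2:\sigma_0\notin\gamma_2\}$. Assume that some $\gamma_1\in\Gamma_1$ does not contain $\sigma_0$. Write $\mathsf{Post}(B,a)=\{s' : \mathbf P(s,a,s')>0\text{ for some }s\in B\}$. **Sensor-revealing game $\mathcal H$.**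 Fix a delay $\tau\in\{0,1,2,\dots\}$ and $\varepsilon\in(0,1)$. The states of $\mathcal H$ are a sink $q_F$, P1's states $(s,B,\kappa)$, nature's states $(s,B,a,\gamma_1,\kappa)$ and P2's states $(s,B,\gamma_1,\kappa)$, with $s\in S$, $B\subseteq S$, $(a,\gamma_1)\in\mathbf A_1$, $\kappa\in\{-1,0,\dots,\tau\}$. The moves are: 1. At $(s,B,\kappa)$, P1 chooses $(a,\gamma_1)\in\mathbf A_1$ and the game moves to $(s,\mathsf{Post}(B,a),a,\gamma_1,\kappa')$, where $\kappa'=\kappa$ if $\kappa=\tau$, or if $\kappa=-1$ and $(a,\gamma_1)\in\mathbf A_1^2$; otherwise $\kappa'=\kappa+1$. 2. At $(s,B,a,\gamma_1,\kappa)$ the game moves to $q_F$ if $\mathsf{Post}(\{s\},a)\subseteq F$; it moves to $(s',B,\gamma_1,\kappa)$ with probability $\mathbf P(s,a,s')$ if $\mathsf{Post}(\{s\},a)\cap F=\emptyset$; otherwise it moves to $q_F$ with probability $\varepsilon$ and to $(s',B,\gamma_1,\kappa)$ with probability $(1-\varepsilon)\mathbf P(s,a,s')$. 3. At $(s,B,\gamma_1,\kappa)$,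 P2 chooses $\gamma_2$, from $\mathbf A_2^2$ if $\kappa<\tau$ and from $\mathbf A_2$ if $\kappa=\tau$, and the game moves to $(s,B\cap\mathsf{Obs}(s,\gamma_1,\gamma_2),\kappa)$. **P2's perceptual game $\mathcal G^2$** is the restriction of $\mathcal H$ to $q_F$ and the states with $\kappa=-1$ (nature's states also with $(a,\gamma_1)\in\mathbf A_1^2$), in which P1 uses only actions in $\mathbf A_1^2$ and P2 only actions in $\mathbf A_2^2$. **Strategies and regions.** A strategy maps every finite play prefix (with states and actions) that ends in a state of the player to a probability distribution on the actions available there. A strategy of P1 is *belief-based* if its choice at $(s,B,\kappa)$ depends only on $(B,\kappa)$. $\mathsf{ASW}_2(\mathcal G^2)$ is the set of states of $\mathcal G^2$ from which P2 has a strategy such that, against every belief-based strategy of P1 in $\mathcal G^2$, $q_F$ is reached with probability $0$. A strategy of P1 in $\mathcal H$ is *positive winning* (respectively *almost-sure winning*) from a state if, against every strategy of P2 in $\mathcal H$, the target is reached from that state with positive probability (respectively with probability $1$). **Lemma.** Let $q=(s,B,-1)\in\mathsf{ASW}_2(\mathcal G^2)$, where $s\in S$ and $B\subseteq S$. Then P1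 has neither a positive winning nor an almost-sure winning strategy from $q$ in $\mathcal H$ for reaching $q_F$, among all strategies, whether or not they query the hidden sensor $\sigma_0$ and whether or not they are belief-based. If moreover $s\notin F$, the same holds when the target is to reach $q_F$ or any state of $\mathcal H$ whose first component lies in $F$. -/

import Mathlib

open MeasureTheory ProbabilityTheory
open scoped NNReal ENNReal

/-! ## Turn-based stochastic games and their plays -/

/-- What happens at a state of a turn-based stochastic game: player 1 moves, choosing one of the
available actions, or nature moves, or player 2 moves, choosing one of the available actions. -/
inductive Turn (Q M₁ M₂ : Type*) where
  | player1 (avail : Set M₁) (next : M₁ → PMF Q)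
  | nature (next : PMF Q)
  | player2 (avail : Set M₂) (next : M₂ → PMF Q)

/-- A two-player turn-based stochastic game with state set `states ⊆ Q`; the values of `turn`
outside `states` are irrelevant. -/
structure TurnGame (Q M₁ M₂ : Type*) where
  states : Set Q
  turn : Q → Turn Q M₁ M₂

/-- One entry of a play: a state, with the action by which it was entered (`none` for the initial
state and after a move of nature). -/
structure Step (Q M₁ M₂ : Type*) where
  state : Q
  action : Option (M₁ ⊕ M₂)

namespace Step

variable {Q M₁ M₂ : Type*}

instance : MeasurableSpace (Step Q M₁ M₂) := ⊤

instance : DiscreteMeasurableSpace (Step Q M₁ M₂) := ⟨fun _ => trivial⟩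

instance [Countable Q] [Countable M₁] [Countable M₂] : Countable (Step Q M₁ M₂) :=
  Function.Injective.countable (f := fun x : Step Q M₁ M₂ => (x.state, x.action)) (by
    rintro ⟨a, b⟩ ⟨c, d⟩ h
    simp only [Prod.mk.injEq] at h
    rw [h.1, h.2])

end Step

/-- The play prefixes with `n + 1` states. -/
abbrev PlayPrefix (Q M₁ M₂ : Type*) (n : ℕ) : Type _ :=
  (i : Finset.Iic n) → Step Q M₁ M₂

/-- The last state of a play prefix. -/
def PlayPrefix.last {Q M₁ M₂ : Type*} {n : ℕ} (h : PlayPrefix Q M₁ M₂ n) : Q :=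
  (h ⟨n, Finset.mem_Iic.2 le_rfl⟩).state

namespace TurnGame

variable {Q M₁ M₂ : Type*}

/-- Randomized, history-dependent strategies of player 1: at each prefix that ends in a state of
player 1, only actions that are available there are chosen. -/
structure Strategy₁ (g : TurnGame Q M₁ M₂) where
  choose : (n : ℕ) → PlayPrefix Q M₁ M₂ n → PMF M₁
  legal : ∀ n (h : PlayPrefix Q M₁ M₂ n) avail next, h.last ∈ g.states →
    g.turn h.last = Turn.player1 avail next → (choose n h).support ⊆ avail

/-- Randomized, history-dependent strategies of player 2. -/
structure Strategy₂ (g : TurnGame Q M₁ M₂) where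
  choose : (n : ℕ) → PlayPrefix Q M₁ M₂ n → PMF M₂
  legal : ∀ n (h : PlayPrefix Q M₁ M₂ n) avail next, h.last ∈ g.states →
    g.turn h.last = Turn.player2 avail next → (choose n h).support ⊆ avail

/-- The distribution of the next entry of the play, after a prefix `h`. -/
noncomputable def nextStep (g : TurnGame Q M₁ M₂) (π₁ : g.Strategy₁) (π₂ : g.Strategy₂)
    (n : ℕ) (h : PlayPrefix Q M₁ M₂ n) : PMF (Step Q M₁ M₂) :=
  match g.turn h.last with
  | .player1 _ next =>
      (π₁.choose n h).bind fun m => (next m).map fun q => ⟨q, some (Sum.inl m)⟩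
  | .nature next => next.map fun q => ⟨q, none⟩
  | .player2 _ next =>
      (π₂.choose n h).bind fun m => (next m).map fun q => ⟨q, some (Sum.inr m)⟩

variable [Countable Q] [Countable M₁] [Countable M₂]

/-- `nextStep` as a Markov kernel. -/
noncomputable def stepKernel (g : TurnGame Q M₁ M₂) (π₁ : g.Strategy₁) (π₂ : g.Strategy₂)
    (n : ℕ) : Kernel (PlayPrefix Q M₁ M₂ n) (Step Q M₁ M₂) where
  toFun h := (g.nextStep π₁ π₂ n h).toMeasure
  measurable' := measurable_of_countable _

instance (g : TurnGame Q M₁ M₂) (π₁ : g.Strategy₁) (π₂ : g.Strategy₂) (n : ℕ) :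
    IsMarkovKernel (g.stepKernel π₁ π₂ n) :=
  ⟨fun h => PMF.toMeasure.isProbabilityMeasure (g.nextStep π₁ π₂ n h)⟩

/-- The law of the infinite play from `q` that is induced by a strategy profile. -/
noncomputable def playMeasure (g : TurnGame Q M₁ M₂) (π₁ : g.Strategy₁) (π₂ : g.Strategy₂)
    (q : Q) : Measure (ℕ → Step Q M₁ M₂) :=
  Kernel.traj (X := fun _ => Step Q M₁ M₂) (g.stepKernel π₁ π₂) 0 (fun _ => ⟨q, none⟩)

/-- The probability that the play from `q` visits the set `T`. -/
noncomputable def reachProb (g : TurnGame Q M₁ M₂) (T : Set Q) (π₁ : g.Strategy₁)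
    (π₂ : g.Strategy₂) (q : Q) : ℝ≥0∞ :=
  g.playMeasure π₁ π₂ q {ω | ∃ n, (ω n).state ∈ T}

/-- States from which player 1 has an almost-sure winning strategy for the objective to reach
`T`. -/
def ASW₁ (g : TurnGame Q M₁ M₂) (T : Set Q) : Set Q :=
  {q ∈ g.states | ∃ π₁ : g.Strategy₁, ∀ π₂ : g.Strategy₂, g.reachProb T π₁ π₂ q = 1}

/-- States from which player 1 has a positive winning strategy for the objective to reach `T`. -/
def PWin₁ (g : TurnGame Q M₁ M₂) (T : Set Q) : Set Q :=
  {q ∈ g.states | ∃ π₁ : g.Strategy₁, ∀ π₂ : g.Strategy₂, 0 < g.reachProb T π₁ π₂ q}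

/-- States from which player 2 has an almost-sure winning strategy when player 1, who wants to
reach `T`, is confined to the strategies in `C`. -/
def ASW₂ (g : TurnGame Q M₁ M₂) (C : Set g.Strategy₁) (T : Set Q) : Set Q :=
  {q ∈ g.states | ∃ π₂ : g.Strategy₂, ∀ π₁ ∈ C, g.reachProb T π₁ π₂ q = 0}

end TurnGame

/-! ## The game with active sensing and sensor attacks -/

/-- A stochastic reachability game with active sensing and sensor attacks, with states `S`,
control actions `A` and sensors `Sensor`. -/
structure SensingGame (S A Sensor : Type*) where
  /-- sensor queries of player 1 -/
  Γ₁ : Set (Set Sensor)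
  /-- sensor attacks of player 2 -/
  Γ₂ : Set (Set Sensor)
  /-- transition probabilities -/
  P : S → A → PMF S
  /-- observations -/
  O : Set (Set S)
  obs : S → Γ₁ → Γ₂ → O
  s₀ : S
  o₀ : O
  s₀_mem : s₀ ∈ (o₀ : Set S)
  /-- goal states of player 1 -/
  F : Set S

namespace SensingGame

variable {S A Sensor : Type*}

/-- The states that can be reached from a state in `B` by the control action `a`. -/
def post (G : SensingGame S A Sensor) (B : Set S) (a : A) : Set S :=
  {s' | ∃ s ∈ B, 0 < G.P s a s'}

/-- The values `-1, 0, …, τ` of the delay counter. -/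
abbrev Counter (τ : ℕ) : Type := Set.Icc (-1 : ℤ) (τ : ℤ)

/-- The counter value `-1`: the hidden sensor has not been revealed. -/
def Counter.hidden (τ : ℕ) : Counter τ := ⟨-1, by simp⟩

/-- The states of the sensor-revealing game: `p1 s B κ` of player 1, `nat s B a γ₁ κ` of nature,
`p2 s B γ₁ κ` of player 2, and the final state `qF`. -/
inductive RState (G : SensingGame S A Sensor) (τ : ℕ) where
  | p1 (s : S) (B : Set S) (κ : Counter τ)
  | nat (s : S) (B : Set S) (a : A) (γ₁ : G.Γ₁) (κ : Counter τ)
  | p2 (s : S) (B : Set S) (γ₁ : G.Γ₁) (κ : Counter τ)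
  | qF

instance (G : SensingGame S A Sensor) (τ : ℕ) [Finite S] [Finite A] [Finite Sensor] :
    Finite (G.RState τ) :=
  Finite.of_injective
    (β := (S × Set S × Counter τ) ⊕ (S × Set S × A × G.Γ₁ × Counter τ) ⊕
      (S × Set S × G.Γ₁ × Counter τ) ⊕ Unit)
    (fun q => match q with
      | .p1 s B κ => .inl (s, B, κ)
      | .nat s B a γ₁ κ => .inr (.inl (s, B, a, γ₁, κ))
      | .p2 s B γ₁ κ => .inr (.inr (.inl (s, B, γ₁, κ)))
      | .qF => .inr (.inr (.inr ())))
    (by intro x y h; cases x <;> cases y <;> simp_all)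

/-- Perception-control actions of player 1: a control action and a sensor query. -/
abbrev Act₁ (G : SensingGame S A Sensor) : Type _ := A × G.Γ₁

/-- The actions of player 1 that do not query the sensor `σ₀`. -/
def knownAct₁ (G : SensingGame S A Sensor) (σ₀ : Sensor) : Set G.Act₁ :=
  {m | σ₀ ∉ (m.2 : Set Sensor)}

/-- The attacks of player 2 that do not attack the sensor `σ₀`. -/
def knownAct₂ (G : SensingGame S A Sensor) (σ₀ : Sensor) : Set G.Γ₂ :=
  {γ₂ | σ₀ ∉ (γ₂ : Set Sensor)}

open Classical in
/-- The delay counter after player 1 has played the action `m` at counter value `κ`. -/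
noncomputable def nextCounter (G : SensingGame S A Sensor) (σ₀ : Sensor) {τ : ℕ}
    (κ : Counter τ) (m : G.Act₁) : Counter τ :=
  if hτ : (κ : ℤ) = τ then κ
  else if (κ : ℤ) = -1 ∧ m ∈ G.knownAct₁ σ₀ then κ
  else ⟨κ + 1, by have h₁ := κ.2.1; have h₂ := κ.2.2; constructor <;> omega⟩

/-- The mixture that draws from `p` with probability `ε` and from `r` with probability `1 - ε`. -/
noncomputable def mixture {X : Type*} (ε : Set.Ioo (0 : ℝ≥0) 1) (p r : PMF X) : PMF X :=
  (PMF.ofFintype (fun b : Bool => if b then ((ε : ℝ≥0) : ℝ≥0∞) else 1 - ((ε : ℝ≥0) : ℝ≥0∞))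
    (by simpa using add_tsub_cancel_of_le (ENNReal.coe_le_one_iff.2 ε.2.2.le))).bind
    fun b => if b then p else r

open Classical in
/-- The move of nature at its state `nat s B a γ₁ κ`. -/
noncomputable def natureMove (G : SensingGame S A Sensor) {τ : ℕ} (ε : Set.Ioo (0 : ℝ≥0) 1)
    (s : S) (B : Set S) (a : A) (γ₁ : G.Γ₁) (κ : Counter τ) : PMF (G.RState τ) :=
  let move : PMF (G.RState τ) := (G.P s a).map fun s' => .p2 s' B γ₁ κ
  if G.post {s} a ⊆ G.F then PMF.pure .qF
  else if G.post {s} a ∩ G.F = ∅ then move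
  else mixture ε (PMF.pure .qF) move

open Classical in
/-- The sensor-revealing game with hidden sensor `σ₀` and delay `τ`. When nature may, but need
not, reach a goal state, the final state `qF` is entered with probability `ε`. -/
noncomputable def revealingGame (G : SensingGame S A Sensor) (σ₀ : Sensor) (τ : ℕ)
    (ε : Set.Ioo (0 : ℝ≥0) 1) : TurnGame (G.RState τ) G.Act₁ G.Γ₂ where
  states := Set.univ
  turn q := match q with
    | .p1 s B κ => .player1 Set.univ fun m =>
        PMF.pure (.nat s (G.post B m.1) m.1 m.2 (G.nextCounter σ₀ κ m))
    | .nat s B a γ₁ κ => .nature (G.natureMove ε s B a γ₁ κ)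
    | .p2 s B γ₁ κ =>
        .player2 (if (κ : ℤ) < τ then G.knownAct₂ σ₀ else Set.univ) fun γ₂ =>
          PMF.pure (.p1 s (B ∩ (G.obs s γ₁ γ₂ : Set S)) κ)
    | .qF => .nature (PMF.pure .qF)

/-- The states of the belief-augmented perceptual game of player 2: the hidden sensor has not been
revealed, and nature's states come from actions known to player 2. -/
def perceptualStates (G : SensingGame S A Sensor) (σ₀ : Sensor) (τ : ℕ) : Set (G.RState τ) :=
  {q | match q with
    | .p1 _ _ κ => (κ : ℤ) = -1
    | .nat _ _ a γ₁ κ => (κ : ℤ) = -1 ∧ (a, γ₁) ∈ G.knownAct₁ σ₀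
    | .p2 _ _ _ κ => (κ : ℤ) = -1
    | .qF => True}

/-- The belief-augmented perceptual game of player 2: the restriction of the sensor-revealing game
to `perceptualStates` and to the actions of both players that are known to player 2. -/
noncomputable def perceptualGame (G : SensingGame S A Sensor) (σ₀ : Sensor) (τ : ℕ)
    (ε : Set.Ioo (0 : ℝ≥0) 1) : TurnGame (G.RState τ) G.Act₁ G.Γ₂ where
  states := G.perceptualStates σ₀ τ
  turn q := match (G.revealingGame σ₀ τ ε).turn q with
    | .player1 avail next => .player1 (avail ∩ G.knownAct₁ σ₀) next
    | .nature next => .nature next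
    | .player2 avail next => .player2 (avail ∩ G.knownAct₂ σ₀) next

/-- The belief-based strategies of player 1: at a state `p1 s B κ` the choice depends on `B` and
`κ` only. -/
def beliefBased (G : SensingGame S A Sensor) {τ : ℕ} (g : TurnGame (G.RState τ) G.Act₁ G.Γ₂) :
    Set g.Strategy₁ :=
  {π₁ | ∀ n n' (h : PlayPrefix (G.RState τ) G.Act₁ G.Γ₂ n)
      (h' : PlayPrefix (G.RState τ) G.Act₁ G.Γ₂ n') s s' B κ,
      h.last = .p1 s B κ → h'.last = .p1 s' B κ → π₁.choose n h = π₁.choose n' h'}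

/-- The states whose underlying state of `G` is a goal state, together with the final state. -/
def visitsGoal (G : SensingGame S A Sensor) (τ : ℕ) : Set (G.RState τ) :=
  {q | match q with
    | .p1 s _ _ => s ∈ G.F
    | .nat s _ _ _ _ => s ∈ G.F
    | .p2 s _ _ _ => s ∈ G.F
    | .qF => True}

end SensingGame

/-! Write `Edge` for the graph on `S` of the moves that have positive probability under some control
action. Beliefs, queries and attacks influence which actions are chosen, but never the support of a
move of nature, and `qF` is entered only from a state with an edge into `F`.

A uniformly random control action with a fixed query avoiding `σ₀` is a constant choice, hence
belief-based, and it is legal in the perceptual game. Against every attack it follows each finite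
path of the graph with positive probability, until it meets a state with an edge into `F`, from
where `qF` has positive probability. So if player 2 wins the perceptual game from `(s, B, -1)`, no
path of positive length from `s` ends in `F` (`notMem_F_of_mem_ASW₂`).

This conclusion concerns the graph alone, so it survives in the revealing game: whatever either
player does, the underlying state stays in the set reachable from `s`, and nature never moves to
`qF` (`nextStep_mem_statesOver`). One legal strategy of player 2, a constant attack, therefore gives
probability `0` against every strategy of player 1. Only the initial state may lie in `F`, whence
the condition `s ∉ G.F` for the larger target. -/

/-! ### Laws of the state at a fixed time, invariants and positive-probability visits. -/

namespace TurnGame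

variable {Q M₁ M₂ : Type*} [Countable Q] [Countable M₁] [Countable M₂]

instance (g : TurnGame Q M₁ M₂) (π₁ : g.Strategy₁) (π₂ : g.Strategy₂) (q : Q) :
    IsProbabilityMeasure (g.playMeasure π₁ π₂ q) := by
  unfold playMeasure
  infer_instance

theorem playMeasure_state_zero (g : TurnGame Q M₁ M₂) (π₁ : g.Strategy₁) (π₂ : g.Strategy₂)
    (q : Q) (T : Set Q) [Decidable (q ∈ T)] :
    g.playMeasure π₁ π₂ q {ω | (ω 0).state ∈ T} = if q ∈ T then 1 else 0 := by
  have h := Kernel.traj_map_frestrictLe_apply (X := fun _ => Step Q M₁ M₂)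
    (κ := g.stepKernel π₁ π₂) 0 0 (fun _ => ⟨q, none⟩)
  have hm : MeasurableSet {h : PlayPrefix Q M₁ M₂ 0 | h.last ∈ T} := .of_discrete
  have := congrArg (fun μ => μ {h : PlayPrefix Q M₁ M₂ 0 | h.last ∈ T}) h
  simp only [Kernel.partialTraj_self, Kernel.id_apply] at this
  rw [Measure.map_apply (by fun_prop) hm, Measure.dirac_apply' _ hm] at this
  refine Eq.trans ?_ (this.trans ?_)
  · rfl
  · by_cases hq : q ∈ T <;> simp [PlayPrefix.last, hq]

/-- The law of the first `n + 2` entries is that of the first `n + 1` followed by one step of the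
kernel. -/
theorem playMeasure_state_succ (g : TurnGame Q M₁ M₂) (π₁ : g.Strategy₁) (π₂ : g.Strategy₂)
    (q : Q) (n : ℕ) (T : Set Q) :
    g.playMeasure π₁ π₂ q {ω | (ω (n + 1)).state ∈ T} =
      ∫⁻ ω, (g.nextStep π₁ π₂ n (Preorder.frestrictLe n ω)).toMeasure {x | x.state ∈ T}
        ∂g.playMeasure π₁ π₂ q := by
  set κ := g.stepKernel π₁ π₂
  set x₀ : PlayPrefix Q M₁ M₂ 0 := fun _ => ⟨q, none⟩
  have hT : MeasurableSet {x : Step Q M₁ M₂ | x.state ∈ T} := .of_discrete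
  have hT' : MeasurableSet {h : PlayPrefix Q M₁ M₂ (n + 1) | h.last ∈ T} := .of_discrete
  have hκ : Measurable fun h : PlayPrefix Q M₁ M₂ n => κ n h {x | x.state ∈ T} :=
    measurable_of_countable _
  have h₁ : g.playMeasure π₁ π₂ q {ω | (ω (n + 1)).state ∈ T} =
      Kernel.partialTraj (X := fun _ => Step Q M₁ M₂) κ 0 (n + 1) x₀
        {h | PlayPrefix.last h ∈ T} := by
    rw [← Kernel.traj_map_frestrictLe_apply, Measure.map_apply (by fun_prop) hT']
    rfl
  have h₂ (h : PlayPrefix Q M₁ M₂ n) :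
      Kernel.partialTraj (X := fun _ => Step Q M₁ M₂) κ n (n + 1) h
        {h | PlayPrefix.last h ∈ T} =
        κ n h {x | x.state ∈ T} := by
    conv_rhs => rw [← Kernel.map_partialTraj_succ_self (X := fun _ => Step Q M₁ M₂) (κ := κ) n]
    rw [Kernel.map_apply' _ (by fun_prop) _ hT]
    rfl
  rw [h₁, Kernel.partialTraj_succ_eq_comp (Nat.zero_le n), Kernel.comp_apply' _ _ _ hT']
  simp_rw [h₂]
  rw [← Kernel.traj_map_frestrictLe_apply, lintegral_map hκ (by fun_prop)]
  rfl

/-- By induction, leaving `I` at time `n` is a null event for each `n`; a visit to `T` lies in the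
countable union of these events. -/
theorem reachProb_eq_zero_of_invariant (g : TurnGame Q M₁ M₂) (π₁ : g.Strategy₁)
    (π₂ : g.Strategy₂) {q : Q} {T I : Set Q} (hq : q ∈ I) (hIT : Disjoint I T)
    (hI : ∀ n (h : PlayPrefix Q M₁ M₂ n), h.last ∈ I →
      ∀ x ∈ (g.nextStep π₁ π₂ n h).support, x.state ∈ I) :
    g.reachProb T π₁ π₂ q = 0 := by
  classical
  have key (n : ℕ) : g.playMeasure π₁ π₂ q {ω | (ω n).state ∈ Iᶜ} = 0 := by
    induction n with
    | zero => rw [playMeasure_state_zero, if_neg (by simpa using hq)]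
    | succ n ih =>
      rw [playMeasure_state_succ]
      refine (lintegral_congr_ae ?_).trans lintegral_zero
      filter_upwards [measure_eq_zero_iff_ae_notMem.1 ih] with ω hω
      rw [PMF.toMeasure_apply_eq_zero_iff _ .of_discrete, Set.disjoint_left]
      intro x hx hxI
      exact hxI (hI n (Preorder.frestrictLe n ω) (Set.notMem_compl_iff.1 hω) x hx)
  refine measure_mono_null ?_ (measure_iUnion_null key)
  rintro ω ⟨n, hn⟩
  exact Set.mem_iUnion.2 ⟨n, fun h => Set.disjoint_left.1 hIT h hn⟩

/-- From `q`, the play is in `T` at time `n` with positive probability. -/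
def Hits (g : TurnGame Q M₁ M₂) (π₁ : g.Strategy₁) (π₂ : g.Strategy₂) (q : Q) (n : ℕ)
    (T : Set Q) : Prop :=
  0 < g.playMeasure π₁ π₂ q {ω | (ω n).state ∈ T}

namespace Hits

variable {g : TurnGame Q M₁ M₂} {π₁ : g.Strategy₁} {π₂ : g.Strategy₂} {q : Q} {n : ℕ}
  {T T' : Set Q}

theorem zero (hq : q ∈ T) : g.Hits π₁ π₂ q 0 T := by
  classical
  simp [Hits, playMeasure_state_zero, hq]

/-- Since only positivity is tracked, one support point of the next step suffices after each prefix;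
no lower bound uniform in the prefix is needed. -/
theorem succ (h : g.Hits π₁ π₂ q n T)
    (hT : ∀ p : PlayPrefix Q M₁ M₂ n, p.last ∈ T →
      ∃ x ∈ (g.nextStep π₁ π₂ n p).support, x.state ∈ T') :
    g.Hits π₁ π₂ q (n + 1) T' := by
  refine pos_iff_ne_zero.2 fun h0 => h.ne' ?_
  rw [playMeasure_state_succ, lintegral_eq_zero_iff] at h0
  · refine measure_eq_zero_iff_ae_notMem.2 ?_
    filter_upwards [h0] with ω hω hωT
    obtain ⟨x, hx, hxT⟩ := hT (Preorder.frestrictLe n ω) hωT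
    exact Set.disjoint_left.1 ((PMF.toMeasure_apply_eq_zero_iff _ .of_discrete).1 hω) hx hxT
  · exact (measurable_of_countable fun h : PlayPrefix Q M₁ M₂ n =>
      (g.nextStep π₁ π₂ n h).toMeasure {x | x.state ∈ T'}).comp (by fun_prop)

theorem reachProb_pos (h : g.Hits π₁ π₂ q n T) : 0 < g.reachProb T π₁ π₂ q :=
  h.trans_le (measure_mono fun _ hω => ⟨n, hω⟩)

end Hits

end TurnGame

/-! ### The graph of possible moves and the support of nature's moves. -/

namespace SensingGame

variable {S A Sensor : Type*}

/-- Some control action moves from `s` to `s'` with positive probability. -/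
def Edge (G : SensingGame S A Sensor) (s s' : S) : Prop :=
  ∃ a, s' ∈ G.post {s} a

theorem mem_post_singleton (G : SensingGame S A Sensor) {s s' : S} {a : A} :
    s' ∈ G.post {s} a ↔ s' ∈ (G.P s a).support := by
  simp [post, pos_iff_ne_zero]

theorem mem_support_mixture {X : Type*} {ε : Set.Ioo (0 : ℝ≥0) 1} {p r : PMF X} {x : X} :
    x ∈ (mixture ε p r).support ↔ x ∈ p.support ∨ x ∈ r.support := by
  have h₀ : ((ε : ℝ≥0) : ℝ≥0∞) ≠ 0 := by simpa using ε.2.1.ne'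
  have h₁ : 1 - ((ε : ℝ≥0) : ℝ≥0∞) ≠ 0 := by
    simpa [tsub_eq_zero_iff_le] using ε.2.2
  rw [mixture, PMF.mem_support_bind_iff]
  simp [h₀, h₁, or_comm]

section NatureMove

variable (G : SensingGame S A Sensor) {τ : ℕ} (ε : Set.Ioo (0 : ℝ≥0) 1) {s : S} (B : Set S)
  {a : A} (γ₁ : G.Γ₁) (κ : Counter τ)

theorem qF_mem_support_natureMove {s' : S} (hs' : s' ∈ G.post {s} a) (hF : s' ∈ G.F) :
    RState.qF ∈ (G.natureMove ε s B a γ₁ κ).support := by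
  have h : G.post {s} a ∩ G.F ≠ ∅ := Set.Nonempty.ne_empty ⟨s', hs', hF⟩
  unfold natureMove
  split_ifs
  · simp
  · exact mem_support_mixture.2 (.inl (by simp))

theorem mem_support_natureMove_of_disjoint (h : G.post {s} a ∩ G.F = ∅) {q : G.RState τ} :
    q ∈ (G.natureMove ε s B a γ₁ κ).support ↔ ∃ s' ∈ G.post {s} a, .p2 s' B γ₁ κ = q := by
  -- A distribution has nonempty support, so a successor set disjoint from `G.F` is not contained in
  -- it and the first branch of `natureMove` is excluded.
  have hne : ¬ G.post {s} a ⊆ G.F := by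
    obtain ⟨s', hs'⟩ := (G.P s a).support_nonempty
    rw [← mem_post_singleton] at hs'
    exact fun hsub => (Set.eq_empty_iff_forall_notMem.1 h s') ⟨hs', hsub hs'⟩
  unfold natureMove
  rw [if_neg hne, if_pos h]
  simp only [PMF.mem_support_map_iff, mem_post_singleton]

end NatureMove

/-! ### Invariance over a closed set of underlying states. -/

/-- The states of the sensor-revealing game, other than `qF`, whose underlying state lies in
`X`. -/
def statesOver (G : SensingGame S A Sensor) (τ : ℕ) (X : Set S) : Set (G.RState τ) :=
  {q | match q with
    | .p1 s _ _ => s ∈ X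
    | .nat s _ _ _ _ => s ∈ X
    | .p2 s _ _ _ => s ∈ X
    | .qF => False}

/-- The players' moves keep the underlying state, and with no edge from `X` into `G.F` nature makes
its ordinary move. Legality of the strategies plays no role. -/
theorem nextStep_mem_statesOver (G : SensingGame S A Sensor) (σ₀ : Sensor) (τ : ℕ)
    (ε : Set.Ioo (0 : ℝ≥0) 1) (π₁ : (G.revealingGame σ₀ τ ε).Strategy₁)
    (π₂ : (G.revealingGame σ₀ τ ε).Strategy₂) {X : Set S}
    (hX : ∀ s ∈ X, ∀ s', G.Edge s s' → s' ∈ X ∧ s' ∉ G.F) {n : ℕ}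
    (h : PlayPrefix (G.RState τ) G.Act₁ G.Γ₂ n) (hh : h.last ∈ G.statesOver τ X)
    (x : Step (G.RState τ) G.Act₁ G.Γ₂)
    (hx : x ∈ ((G.revealingGame σ₀ τ ε).nextStep π₁ π₂ n h).support) :
    x.state ∈ G.statesOver τ X := by
  unfold TurnGame.nextStep at hx
  cases hl : h.last with
  | p1 s B κ =>
    rw [hl] at hh hx
    simp only [revealingGame, PMF.mem_support_bind_iff, PMF.mem_support_map_iff,
      PMF.mem_support_pure_iff] at hx
    obtain ⟨m, -, _, rfl, rfl⟩ := hx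
    exact hh
  | nat s B a γ₁ κ =>
    rw [hl] at hh hx
    simp only [revealingGame, PMF.mem_support_map_iff] at hx
    have hd : G.post {s} a ∩ G.F = ∅ :=
      Set.eq_empty_iff_forall_notMem.2 fun s' hs' => (hX s hh s' ⟨a, hs'.1⟩).2 hs'.2
    obtain ⟨_, hq, rfl⟩ := hx
    obtain ⟨s', hs', rfl⟩ := (G.mem_support_natureMove_of_disjoint ε B γ₁ κ hd).1 hq
    exact (hX s hh s' ⟨a, hs'⟩).1
  | p2 s B γ₁ κ =>
    rw [hl] at hh hx
    simp only [revealingGame, PMF.mem_support_bind_iff, PMF.mem_support_map_iff,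
      PMF.mem_support_pure_iff] at hx
    obtain ⟨m, -, _, rfl, rfl⟩ := hx
    exact hh
  | qF => rw [hl] at hh; exact hh.elim

/-! ### The two strategies used as witnesses. -/

/-- The strategy of player 1 in the perceptual game that plays a uniformly random control action
together with the fixed query `γ₁`. -/
noncomputable def uniformControl (G : SensingGame S A Sensor) (σ₀ : Sensor) (τ : ℕ)
    (ε : Set.Ioo (0 : ℝ≥0) 1) [Fintype A] [Nonempty A] (γ₁ : G.Γ₁)
    (hγ₁ : σ₀ ∉ (γ₁ : Set Sensor)) : (G.perceptualGame σ₀ τ ε).Strategy₁ where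
  choose _ _ := (PMF.uniformOfFintype A).map fun a => (a, γ₁)
  legal n h avail next _ ht := by
    cases hl : h.last <;> rw [hl] at ht <;> simp only [perceptualGame, revealingGame] at ht
    · cases ht
      rintro m hm
      obtain ⟨a, -, rfl⟩ := (PMF.mem_support_map_iff _ _ _).1 hm
      exact ⟨trivial, hγ₁⟩
    all_goals cases ht

theorem uniformControl_mem_beliefBased (G : SensingGame S A Sensor) (σ₀ : Sensor) (τ : ℕ)
    (ε : Set.Ioo (0 : ℝ≥0) 1) [Fintype A] [Nonempty A] (γ₁ : G.Γ₁)
    (hγ₁ : σ₀ ∉ (γ₁ : Set Sensor)) :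
    G.uniformControl σ₀ τ ε γ₁ hγ₁ ∈ G.beliefBased (G.perceptualGame σ₀ τ ε) :=
  fun _ _ _ _ _ _ _ _ _ _ => rfl

/-- The strategy of player 2 in the sensor-revealing game that always plays the attack `γ₂`. -/
noncomputable def constantAttack (G : SensingGame S A Sensor) (σ₀ : Sensor) (τ : ℕ)
    (ε : Set.Ioo (0 : ℝ≥0) 1) (γ₂ : G.Γ₂) (hγ₂ : γ₂ ∈ G.knownAct₂ σ₀) :
    (G.revealingGame σ₀ τ ε).Strategy₂ where
  choose _ _ := PMF.pure γ₂
  legal n h avail next _ ht := by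
    cases hl : h.last <;> rw [hl] at ht <;> simp only [revealingGame] at ht
    case p2 =>
      cases ht
      rw [PMF.support_pure, Set.singleton_subset_iff]
      split_ifs
      exacts [hγ₂, trivial]
    all_goals cases ht

/-- Strategies are defined on all prefixes, also those that no play produces, so legality at an
artificial state of player 2 with counter `-1` yields an attack that spares `σ₀`. -/
theorem exists_mem_knownAct₂ (G : SensingGame S A Sensor) (σ₀ : Sensor) (τ : ℕ)
    (ε : Set.Ioo (0 : ℝ≥0) 1) (π₂ : (G.perceptualGame σ₀ τ ε).Strategy₂) (s : S) (γ₁ : G.Γ₁) :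
    (G.knownAct₂ σ₀).Nonempty := by
  let h : PlayPrefix (G.RState τ) G.Act₁ G.Γ₂ 0 :=
    fun _ => ⟨.p2 s ∅ γ₁ (Counter.hidden τ), none⟩
  obtain ⟨γ₂, hγ₂⟩ := (π₂.choose 0 h).support_nonempty
  exact ⟨γ₂, (π₂.legal 0 h _ _ (show ((Counter.hidden τ : Counter τ) : ℤ) = -1 from rfl) rfl
    hγ₂).2⟩

/-! ### Random control follows the graph with positive probability. -/

section Perceptual

variable [Finite S] [Finite Sensor] [Fintype A] [Nonempty A] {G : SensingGame S A Sensor}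
  {σ₀ : Sensor} {τ : ℕ} {ε : Set.Ioo (0 : ℝ≥0) 1} {γ₁ : G.Γ₁} {hγ₁ : σ₀ ∉ (γ₁ : Set Sensor)}
  {π₂ : (G.perceptualGame σ₀ τ ε).Strategy₂} {q : G.RState τ} {n : ℕ} {s s' : S}

theorem hits_nat (hs : (G.perceptualGame σ₀ τ ε).Hits (G.uniformControl σ₀ τ ε γ₁ hγ₁) π₂ q n
      {q | ∃ B κ, q = .p1 s B κ}) (a : A) :
    (G.perceptualGame σ₀ τ ε).Hits (G.uniformControl σ₀ τ ε γ₁ hγ₁) π₂ q (n + 1)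
      {q | ∃ B γ₁ κ, q = .nat s B a γ₁ κ} := by
  refine hs.succ ?_
  rintro p ⟨B, κ, hp⟩
  refine ⟨⟨.nat s (G.post B a) a γ₁ (G.nextCounter σ₀ κ (a, γ₁)), some (.inl (a, γ₁))⟩, ?_,
    _, _, _, rfl⟩
  unfold TurnGame.nextStep
  rw [hp]
  simp only [perceptualGame, revealingGame, PMF.mem_support_bind_iff, PMF.mem_support_map_iff]
  exact ⟨(a, γ₁), (PMF.mem_support_map_iff _ _ _).2 ⟨a, by simp, rfl⟩, _, by simp, rfl⟩

theorem hits_qF (hs : (G.perceptualGame σ₀ τ ε).Hits (G.uniformControl σ₀ τ ε γ₁ hγ₁) π₂ q n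
      {q | ∃ B κ, q = .p1 s B κ}) (he : G.Edge s s') (hF : s' ∈ G.F) :
    ∃ k, (G.perceptualGame σ₀ τ ε).Hits (G.uniformControl σ₀ τ ε γ₁ hγ₁) π₂ q k {.qF} := by
  obtain ⟨a, ha⟩ := he
  refine ⟨_, (hits_nat hs a).succ ?_⟩
  rintro p ⟨B, γ, κ, hp⟩
  refine ⟨⟨.qF, none⟩, ?_, rfl⟩
  unfold TurnGame.nextStep
  rw [hp]
  simp only [perceptualGame, revealingGame, PMF.mem_support_map_iff]
  exact ⟨_, G.qF_mem_support_natureMove ε B γ κ ha hF, rfl⟩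

/-- A round consists of three moves. Without an edge from `s` into `G.F`, nature reaches every
successor of `s`; otherwise it might be sent to `qF` with certainty. The attack affects only the
belief, so any `γ₂` in the support will do. -/
theorem hits_p1 (hs : (G.perceptualGame σ₀ τ ε).Hits (G.uniformControl σ₀ τ ε γ₁ hγ₁) π₂ q n
      {q | ∃ B κ, q = .p1 s B κ}) (hF : ∀ t, G.Edge s t → t ∉ G.F) (he : G.Edge s s') :
    ∃ k, (G.perceptualGame σ₀ τ ε).Hits (G.uniformControl σ₀ τ ε γ₁ hγ₁) π₂ q k
      {q | ∃ B κ, q = .p1 s' B κ} := by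
  obtain ⟨a, ha⟩ := he
  have hd : G.post {s} a ∩ G.F = ∅ :=
    Set.eq_empty_iff_forall_notMem.2 fun t ht => hF t ⟨a, ht.1⟩ ht.2
  refine ⟨_, ((hits_nat hs a).succ (T' := {q | ∃ B γ₁ κ, q = .p2 s' B γ₁ κ}) ?_).succ ?_⟩
  · rintro p ⟨B, γ, κ, hp⟩
    refine ⟨⟨.p2 s' B γ κ, none⟩, ?_, _, _, _, rfl⟩
    unfold TurnGame.nextStep
    rw [hp]
    simp only [perceptualGame, revealingGame, PMF.mem_support_map_iff]
    exact ⟨_, (G.mem_support_natureMove_of_disjoint ε B γ κ hd).2 ⟨s', ha, rfl⟩, rfl⟩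
  · rintro p ⟨B, γ, κ, hp⟩
    obtain ⟨γ₂, hγ₂⟩ := (π₂.choose _ p).support_nonempty
    refine ⟨⟨.p1 s' (B ∩ (G.obs s' γ γ₂ : Set S)) κ, some (.inr γ₂)⟩, ?_, _, _, rfl⟩
    unfold TurnGame.nextStep
    rw [hp]
    simp only [perceptualGame, revealingGame, PMF.mem_support_bind_iff,
      PMF.mem_support_map_iff]
    exact ⟨γ₂, hγ₂, _, by simp, rfl⟩

end Perceptual

/-! ### Transfer from the perceptual game to the revealing game. -/

theorem notMem_F_of_mem_ASW₂ [Finite S] [Finite A] [Finite Sensor] (G : SensingGame S A Sensor)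
    (σ₀ : Sensor) (hΓ₁ : ∃ γ₁ ∈ G.Γ₁, σ₀ ∉ γ₁) (τ : ℕ) (ε : Set.Ioo (0 : ℝ≥0) 1) {s s' t : S}
    {B : Set S} {κ : Counter τ}
    (hq : .p1 s B κ ∈ (G.perceptualGame σ₀ τ ε).ASW₂
      (G.beliefBased (G.perceptualGame σ₀ τ ε)) {.qF})
    (hs : Relation.ReflTransGen G.Edge s s') (ht : G.Edge s' t) : t ∉ G.F := by
  obtain ⟨-, π₂, hπ₂⟩ := hq
  obtain ⟨γ, hγ, hσ⟩ := hΓ₁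
  have : Nonempty A := ⟨ht.choose⟩
  have := Fintype.ofFinite A
  let π₁ := G.uniformControl σ₀ τ ε ⟨γ, hγ⟩ hσ
  have h0 := hπ₂ π₁ (G.uniformControl_mem_beliefBased σ₀ τ ε _ hσ)
  have safe {u v : S} {n : ℕ} (hn : (G.perceptualGame σ₀ τ ε).Hits π₁ π₂ (.p1 s B κ) n
      {q | ∃ B κ, q = .p1 u B κ}) (he : G.Edge u v) : v ∉ G.F := fun hF =>
    let ⟨_, hk⟩ := hits_qF hn he hF
    hk.reachProb_pos.ne' h0
  suffices h : ∃ n, (G.perceptualGame σ₀ τ ε).Hits π₁ π₂ (.p1 s B κ) n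
      {q | ∃ B κ, q = .p1 s' B κ} from safe h.choose_spec ht
  clear ht
  induction hs with
  | refl => exact ⟨0, .zero ⟨B, κ, rfl⟩⟩
  | tail _ he ih =>
    obtain ⟨n, hn⟩ := ih
    -- The state reached so far is itself safe: an edge from it into `G.F` would already contradict
    -- `h0`. This is what lets the path be extended.
    exact hits_p1 hn (fun _ => safe hn) he

theorem not_mem_PWin₁_and_not_mem_ASW₁ [Finite S] [Finite A] [Finite Sensor]
    (G : SensingGame S A Sensor) (σ₀ : Sensor) (τ : ℕ) (ε : Set.Ioo (0 : ℝ≥0) 1)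
    {T : Set (G.RState τ)} {q : G.RState τ} (π₂ : (G.revealingGame σ₀ τ ε).Strategy₂)
    (h : ∀ π₁, (G.revealingGame σ₀ τ ε).reachProb T π₁ π₂ q = 0) :
    q ∉ (G.revealingGame σ₀ τ ε).PWin₁ T ∧ q ∉ (G.revealingGame σ₀ τ ε).ASW₁ T :=
  ⟨fun ⟨_, π₁, hπ₁⟩ => (hπ₁ π₂).ne' (h π₁),
    fun ⟨_, π₁, hπ₁⟩ => zero_ne_one ((h π₁).symm.trans (hπ₁ π₂))⟩

end SensingGame

theorem mainTheorem3 {S A Sensor : Type*} [Finite S] [Finite A] [Finite Sensor]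
    (G : SensingGame S A Sensor) (σ₀ : Sensor) (hΓ₁ : ∃ γ₁ ∈ G.Γ₁, σ₀ ∉ γ₁)
    (τ : ℕ) (ε : Set.Ioo (0 : ℝ≥0) 1) (s : S) (B : Set S)
    (hq : SensingGame.RState.p1 s B (SensingGame.Counter.hidden τ) ∈
      (G.perceptualGame σ₀ τ ε).ASW₂ (G.beliefBased (G.perceptualGame σ₀ τ ε))
        {SensingGame.RState.qF}) :
    SensingGame.RState.p1 s B (SensingGame.Counter.hidden τ) ∉
        (G.revealingGame σ₀ τ ε).PWin₁ {SensingGame.RState.qF} ∧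
      SensingGame.RState.p1 s B (SensingGame.Counter.hidden τ) ∉
        (G.revealingGame σ₀ τ ε).ASW₁ {SensingGame.RState.qF} ∧
      (s ∉ G.F →
        SensingGame.RState.p1 s B (SensingGame.Counter.hidden τ) ∉
            (G.revealingGame σ₀ τ ε).PWin₁ (G.visitsGoal τ) ∧
          SensingGame.RState.p1 s B (SensingGame.Counter.hidden τ) ∉
            (G.revealingGame σ₀ τ ε).ASW₁ (G.visitsGoal τ)) := by
  obtain ⟨-, π₂, -⟩ := id hq
  obtain ⟨γ₁, hγ₁, -⟩ := id hΓ₁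
  obtain ⟨γ₂, hγ₂⟩ := G.exists_mem_knownAct₂ σ₀ τ ε π₂ s ⟨γ₁, hγ₁⟩
  have safe {s' t : S} := G.notMem_F_of_mem_ASW₂ σ₀ hΓ₁ τ ε (s' := s') (t := t) hq
  let π := G.constantAttack σ₀ τ ε γ₂ hγ₂
  have main {X : Set S} {T : Set (G.RState τ)} (hs : s ∈ X) (hT : Disjoint (G.statesOver τ X) T)
      (hX : ∀ s ∈ X, ∀ s', G.Edge s s' → s' ∈ X ∧ s' ∉ G.F) :=
    G.not_mem_PWin₁_and_not_mem_ASW₁ σ₀ τ ε π fun π₁ =>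
      TurnGame.reachProb_eq_zero_of_invariant _ π₁ π
        (show SensingGame.RState.p1 s B (SensingGame.Counter.hidden τ) ∈ G.statesOver τ X from hs) hT
        fun _ h hh => G.nextStep_mem_statesOver σ₀ τ ε π₁ π hX h hh
  -- For the target `qF` the invariant set is everything reachable from `s`, which may contain `s ∈
  -- G.F`. For the larger target it must also avoid `G.F`, and `hF` puts `s` in it.
  refine and_assoc.1 ⟨main (X := {s' | Relation.ReflTransGen G.Edge s s'}) .refl ?_ ?_,
    fun hF => main (X := {s' | Relation.ReflTransGen G.Edge s s' ∧ s' ∉ G.F}) ⟨.refl, hF⟩ ?_ ?_⟩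
  · exact Set.disjoint_singleton_right.2 id
  · exact fun s' hs' t ht => ⟨hs'.tail ht, safe hs' ht⟩
  · refine Set.disjoint_left.2 fun q hq hqF => ?_
    cases q
    case qF => exact hq
    all_goals exact hq.2 hqF
  · exact fun s' hs' t ht => ⟨⟨hs'.1.tail ht, safe hs'.1 ht⟩, safe hs'.1 ht⟩
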